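/- Throughout, a \emph{measure} on $\mathbb{R}^n$ is a complex, locally finite Borel measure $\mu$ which is slowly increasing, i.e. for some $N$ its total variation satisfies $|\mu|(\{x:|x|<R\})=O(R^N)$ as $R\to\infty$; it defines the temperate distribution $\varphi\mapsto\int\varphi\,d\mu$. The Fourier transform of a temperate distribution $\alpha$ is $\langle\hat\alpha,\varphi\rangle=\langle\alpha,\hat\varphi\rangle$, with $\hat\varphi(t)=\int\varphi(x)e^{-2\pi i\langle t,x\rangle}\,dx$. The support of a purely atomic measure is the set of its non-zero atoms. A set $A\subset\mathbb{R}^n$ is uniformly discrete if there is $\delta>0$ such that $|x-y|\ge\delta$ for all distinct $x,y\in A$. \textbf{Theorem.} Let $\mu$ be a purely atomic measure on $\mathbb{R}^n$ whose support $\Lambda$ is uniformly discrete, and assume that its Fourier transform $\hat\mu$ is a (slowly increasing) measure. Let $\hat\mu_d=\sum_{s}\hat\mu(\{s\})\,\delta_s$ be the discrete part of $\hat\mu$, where the sum is over all atoms $s$ of $\hat\mu$. Then there is a purely atomic measure $\mu'$ on $\mathbb{R}^n$ such that: \begin{itemize} \item $\hat\mu_d$ is the Fourier transform of $\mu'$;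 \item $\mu'$ is a weak limit of translates of $\mu$: there are $\tau_j\in\mathbb{R}^n$ $(j\in\mathbb{N})$ such that the measures $\mu(\,\cdot+\tau_j)$ converge to $\mu'$ in the space of temperate distributions, i.e. when tested on any Schwartz function; \item the support $\Lambda'$ of $\mu'$ is uniformly discrete; \item if $\Lambda-\Lambda$ is uniformly discrete, then $\Lambda'-\Lambda'$ is also uniformly discrete. \end{itemize} -/

import Mathlib

open MeasureTheory
open scoped Pointwise SchwartzMap FourierTransform ENNReal Topology

noncomputable section

/-- Euclidean space `ℝⁿ`. -/
abbrev Eucl (n : ℕ) : Type := EuclideanSpace ℝ (Fin n)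

/-- A positive Borel measure `m` on `ℝⁿ` is slowly increasing if `m (B_R) = O(R ^ N)` as `R → ∞`
for some `N`.  (The values `m (B_R)` are then all finite, so that the bound may be asked
for all `R ≥ 1`.) -/
def IsSlowlyIncreasing {n : ℕ} (m : Measure (Eucl n)) : Prop :=
  ∃ N : ℕ, ∃ C : ℝ, ∀ R : ℝ, 1 ≤ R → m (Metric.ball 0 R) ≤ ENNReal.ofReal (C * R ^ N)

theorem IsSlowlyIncreasing.mono {n : ℕ} {m m' : Measure (Eucl n)} (h : IsSlowlyIncreasing m)
    (hle : m' ≤ m) : IsSlowlyIncreasing m' := by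
  obtain ⟨N, C, hC⟩ := h
  exact ⟨N, C, fun R hR => (hle _).trans (hC R hR)⟩

theorem IsSlowlyIncreasing.map_sub {n : ℕ} {m : Measure (Eucl n)} (h : IsSlowlyIncreasing m)
    (τ : Eucl n) : IsSlowlyIncreasing (m.map (fun y => y - τ)) := by
  obtain ⟨N, C, hC⟩ := h
  refine ⟨N, |C| * (1 + ‖τ‖) ^ N, fun R hR => ?_⟩
  rw [Measure.map_apply (by fun_prop) Metric.isOpen_ball.measurableSet]
  have hsub : (fun y => y - τ) ⁻¹' Metric.ball (0 : Eucl n) R ⊆ Metric.ball 0 (R * (1 + ‖τ‖)) := by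
    intro y hy
    simp only [Set.mem_preimage, mem_ball_zero_iff] at hy ⊢
    have h1 : ‖y‖ ≤ ‖y - τ‖ + ‖τ‖ := by
      simpa using norm_add_le (y - τ) τ
    nlinarith [norm_nonneg τ]
  refine (measure_mono hsub).trans ((hC _ ?_).trans (ENNReal.ofReal_le_ofReal ?_))
  · nlinarith [norm_nonneg τ]
  · rw [mul_pow, mul_assoc, mul_comm (R ^ N)]
    exact mul_le_mul_of_nonneg_right (le_abs_self C) (by positivity)

theorem IsSlowlyIncreasing.hasTemperateGrowth {n : ℕ} {m : Measure (Eucl n)}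
    (h : IsSlowlyIncreasing m) : m.HasTemperateGrowth := by
  obtain ⟨N, C, hC⟩ := h
  refine ⟨⟨N + 2, ?_, ?_⟩⟩
  · have : Measurable fun x : Eucl n => (1 + ‖x‖) ^ (-((N + 2 : ℕ) : ℝ)) := by fun_prop
    exact this.aestronglyMeasurable
  · rw [hasFiniteIntegral_iff_enorm]
    have hpt : ∀ x : Eucl n, ‖(1 + ‖x‖) ^ (-((N + 2 : ℕ) : ℝ))‖ₑ ≤
        ∑' k : ℕ, (Metric.ball (0 : Eucl n) (k + 1)).indicator
          (fun _ => ENNReal.ofReal (((k : ℝ) + 1) ^ (N + 2))⁻¹) x := by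
      intro x
      refine le_trans ?_ (ENNReal.le_tsum ⌊‖x‖⌋₊)
      rw [Set.indicator_of_mem (by simpa using Nat.lt_floor_add_one ‖x‖),
        Real.enorm_of_nonneg (by positivity), Real.rpow_neg (by positivity), Real.rpow_natCast]
      refine ENNReal.ofReal_le_ofReal (inv_anti₀ (by positivity) ?_)
      have := Nat.floor_le (norm_nonneg x)
      gcongr ?_ ^ _
      linarith
    refine (lintegral_mono hpt).trans_lt ?_
    rw [lintegral_tsum fun k =>
      (measurable_const.indicator Metric.isOpen_ball.measurableSet).aemeasurable]
    have hterm : ∀ k : ℕ, ∫⁻ x, (Metric.ball (0 : Eucl n) (k + 1)).indicator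
        (fun _ => ENNReal.ofReal (((k : ℝ) + 1) ^ (N + 2))⁻¹) x ∂m ≤
        ENNReal.ofReal (|C| * (1 / ((k + 1 : ℕ) : ℝ) ^ 2)) := by
      intro k
      rw [lintegral_indicator_const Metric.isOpen_ball.measurableSet]
      refine (mul_le_mul_right (hC _ (by simp)) _).trans ?_
      rw [← ENNReal.ofReal_mul (by positivity)]
      refine ENNReal.ofReal_le_ofReal ?_
      have hk : (0 : ℝ) < (k : ℝ) + 1 := by positivity
      calc (((k : ℝ) + 1) ^ (N + 2))⁻¹ * (C * ((k : ℝ) + 1) ^ N)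
          ≤ (((k : ℝ) + 1) ^ (N + 2))⁻¹ * (|C| * ((k : ℝ) + 1) ^ N) := by
            gcongr; exact le_abs_self C
        _ = |C| * (1 / ((k + 1 : ℕ) : ℝ) ^ 2) := by
            push_cast; field_simp; ring
    refine (ENNReal.tsum_le_tsum hterm).trans_lt ?_
    have hs : Summable fun k : ℕ => |C| * (1 / ((k + 1 : ℕ) : ℝ) ^ 2) :=
      ((summable_nat_add_iff 1).2 (Real.summable_one_div_nat_pow.2 one_lt_two)).mul_left _
    rw [← ENNReal.ofReal_tsum_of_nonneg (fun k => by positivity) hs]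
    exact ENNReal.ofReal_lt_top

/-- A slowly increasing complex (locally finite, in general infinite) Borel measure on `ℝⁿ`,
given by its polar decomposition `μ = phase · |μ|`: a slowly increasing positive measure `|μ|`, the
total variation, and a measurable density of modulus one.  The value of `μ` on a bounded Borel
set `A` is `∫_A phase d|μ|`, see `SIMeasure.mass`. -/
structure SIMeasure (n : ℕ) where
  /-- The total variation measure `|μ|`. -/
  variation : Measure (Eucl n)
  /-- The density of `μ` with respect to `|μ|`. -/
  phase : Eucl n → ℂ
  measurable_phase : Measurable phase
  norm_phase : ∀ x, ‖phase x‖ = 1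
  slowlyIncreasing : IsSlowlyIncreasing variation

namespace SIMeasure

variable {n : ℕ}

/-- The value `μ(A)` on a bounded Borel set `A`. -/
def mass (μ : SIMeasure n) (A : Set (Eucl n)) : ℂ :=
  ∫ x in A, μ.phase x ∂μ.variation

/-- The set of points `x` with `μ({x}) ≠ 0`; for a pure point measure this is its support. -/
def atoms (μ : SIMeasure n) : Set (Eucl n) :=
  {x | μ.mass {x} ≠ 0}

/-- `μ` is a pure point (purely atomic) measure: it is carried by the set of its atoms. -/
def IsPurePoint (μ : SIMeasure n) : Prop :=
  μ.variation μ.atomsᶜ = 0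

/-- The discrete (pure point) part `μ_d = ∑ μ({s}) δ_s`, that is the restriction of `μ` to the
(countable) set of its atoms. -/
def discretePart (μ : SIMeasure n) : SIMeasure n where
  variation := μ.variation.restrict μ.atoms
  phase := μ.phase
  measurable_phase := μ.measurable_phase
  norm_phase := μ.norm_phase
  slowlyIncreasing := μ.slowlyIncreasing.mono Measure.restrict_le_self

/-- The translate `A ↦ μ(A + τ)` of `μ`, formally `μ(t + τ)`. -/
def translate (μ : SIMeasure n) (τ : Eucl n) : SIMeasure n where
  variation := μ.variation.map (fun y => y - τ)
  phase := fun x => μ.phase (x + τ)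
  measurable_phase := μ.measurable_phase.comp (by fun_prop)
  norm_phase := fun x => μ.norm_phase (x + τ)
  slowlyIncreasing := μ.slowlyIncreasing.map_sub τ

theorem memLp_phase (μ : SIMeasure n) : MemLp μ.phase ∞ μ.variation :=
  memLp_top_of_bound μ.measurable_phase.aestronglyMeasurable 1
    (Filter.Eventually.of_forall fun x => (μ.norm_phase x).le)

/-- The temperate distribution `φ ↦ ∫ φ dμ` defined by `μ`. -/
def toDistribution (μ : SIMeasure n) : 𝓢'(Eucl n, ℂ) :=
  haveI := μ.slowlyIncreasing.hasTemperateGrowth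
  Lp.toTemperedDistribution (μ.memLp_phase.toLp μ.phase)

theorem toDistribution_apply (μ : SIMeasure n) (φ : 𝓢(Eucl n, ℂ)) :
    μ.toDistribution φ = ∫ x, φ x * μ.phase x ∂μ.variation := by
  have := μ.slowlyIncreasing.hasTemperateGrowth
  rw [toDistribution, Lp.toTemperedDistribution_apply]
  refine integral_congr_ae ?_
  filter_upwards [μ.memLp_phase.coeFn_toLp] with x hx
  rw [hx, smul_eq_mul]

end SIMeasure

/-- A set is uniformly discrete if the distances between its distinct points are bounded below
by a positive constant. -/
def IsUniformlyDiscrete {n : ℕ} (A : Set (Eucl n)) : Prop :=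
  ∃ δ : ℝ, 0 < δ ∧ ∀ x ∈ A, ∀ y ∈ A, x ≠ y → δ ≤ dist x y

end

/-! Translating `μ` by `τ` multiplies its Fourier transform `ν` by the character of frequency `2πτ`.
It therefore suffices to find characters that tend to 1 at every atom of `ν` and to 0 weakly against
its continuous part: the translates then converge to the inverse transform of the discrete part.
`exists_seq_expInner_tendsto` supplies them. Wiener's theorem gives a sequence of frequencies all of
whose differences nearly annihilate the continuous part, and compactness picks a difference whose
character is near 1 at finitely many atoms.

That the limit is a pure point measure comes from `exists_isPurePoint_of_tendsto`. The masses of `μ`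
are bounded, and its atoms are separated, so space splits into cells holding at most one atom each.
Masses and positions converge cell by cell along an ultrafilter, with tails dominated uniformly.
Each atom of the limit is a limit of atoms of translates, so separation of atoms, and of their
differences, is inherited. -/

noncomputable section

open Filter ProbabilityTheory

/-! ### Characters of a Euclidean space. -/

section Character

variable {E : Type*} [NormedAddCommGroup E] [InnerProductSpace ℝ E]

/-- The character `x ↦ exp (i ⟪x, t⟫)` with frequency `t`. -/
def expInner (t x : E) : ℂ := Complex.exp ((inner ℝ x t : ℝ) * Complex.I)

theorem norm_expInner (t x : E) : ‖expInner t x‖ = 1 := Complex.norm_exp_ofReal_mul_I _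

theorem expInner_sub_left (s t x : E) :
    expInner (s - t) x = expInner s x * expInner (-t) x := by
  simp only [expInner, ← Complex.exp_add, inner_sub_right, inner_neg_right]
  congr 1; push_cast; ring

theorem expInner_sub_right (t x y : E) :
    expInner t (x - y) = expInner t x * (starRingEnd ℂ) (expInner t y) := by
  simp only [expInner, ← Complex.exp_conj, ← Complex.exp_add, inner_sub_left, map_mul,
    Complex.conj_ofReal, Complex.conj_I]
  congr 1; push_cast; ring

theorem expInner_neg_left (t x : E) : expInner (-t) x = (starRingEnd ℂ) (expInner t x) := by
  simp [expInner, ← Complex.exp_conj]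

theorem norm_expInner_sub_sub_one (s t x : E) :
    ‖expInner (s - t) x - 1‖ = ‖expInner s x - expInner t x‖ := by
  have h : expInner (-t) x * expInner t x = 1 := by
    rw [expInner_neg_left, mul_comm, Complex.mul_conj, Complex.normSq_eq_norm_sq, norm_expInner]
    simp
  have : expInner (s - t) x - 1 = (expInner s x - expInner t x) * expInner (-t) x := by
    rw [sub_mul, expInner_sub_left, mul_comm (expInner t x), h]
  rw [this, norm_mul, norm_expInner, mul_one]

theorem continuous_expInner (t : E) : Continuous (expInner t) := by
  unfold expInner; fun_prop

theorem MeasureTheory.Integrable.mul_expInner [MeasurableSpace E] [BorelSpace E]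
    [SecondCountableTopology E] {m : Measure E} {g : E → ℂ} (hg : Integrable g m) (t : E) :
    Integrable (fun x => g x * expInner t x) m :=
  hg.mul_bdd (c := 1) (continuous_expInner t).aestronglyMeasurable
    (Eventually.of_forall fun x => (norm_expInner t x).le)

end Character

/-! ### Wiener's theorem with Gaussian averages. -/

section Wiener

variable {E : Type*} [NormedAddCommGroup E] [InnerProductSpace ℝ E] [FiniteDimensional ℝ E]
  [MeasurableSpace E] [BorelSpace E] {m : Measure E} [SFinite m]

theorem integral_expInner_smul_stdGaussian (R : ℝ) (x : E) :
    ∫ z, expInner (R • z) x ∂stdGaussian E = Complex.exp (-(‖R • x‖ : ℂ) ^ 2 / 2) := by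
  rw [← charFun_stdGaussian, charFun_apply]
  refine integral_congr_ae (Eventually.of_forall fun z => ?_)
  simp only [expInner, inner_smul_right, real_inner_comm]

/-- The squared modulus is a double integral of characters at `x - y`; after Fubini, the Gaussian
average turns each into the Gaussian characteristic function. -/
theorem ofReal_integral_normSq_stdGaussian {g : E → ℂ} (hg : Integrable g m) (R : ℝ) :
    ((∫ z, ‖∫ x, g x * expInner (R • z) x ∂m‖ ^ 2 ∂stdGaussian E : ℝ) : ℂ) =
      ∫ p, g p.1 * (starRingEnd ℂ) (g p.2) *
        Complex.exp (-(‖R • (p.1 - p.2)‖ : ℂ) ^ 2 / 2) ∂m.prod m := by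
  have hG : Integrable (fun p : E × E => g p.1 * (starRingEnd ℂ) (g p.2)) (m.prod m) :=
    hg.mul_prod (Complex.conjCLE.toContinuousLinearMap.integrable_comp hg)
  have h1 : ∀ z : E, ((‖∫ x, g x * expInner (R • z) x ∂m‖ ^ 2 : ℝ) : ℂ) =
      ∫ p, g p.1 * (starRingEnd ℂ) (g p.2) * expInner (R • z) (p.1 - p.2) ∂m.prod m := by
    intro z
    have h2 : (fun p : E × E => g p.1 * (starRingEnd ℂ) (g p.2) * expInner (R • z) (p.1 - p.2)) =
        fun p => (g p.1 * expInner (R • z) p.1) *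
          (starRingEnd ℂ) (g p.2 * expInner (R • z) p.2) := by
      funext p
      rw [expInner_sub_right, map_mul]; ring
    rw [h2, integral_prod_mul (fun x => g x * expInner (R • z) x)
      (fun x => (starRingEnd ℂ) (g x * expInner (R • z) x)), integral_conj, Complex.mul_conj,
      Complex.normSq_eq_norm_sq]
  rw [← integral_complex_ofReal]
  simp_rw [h1]
  rw [integral_integral_swap]
  · refine integral_congr_ae (Eventually.of_forall fun p => ?_)
    simp only
    rw [integral_const_mul, integral_expInner_smul_stdGaussian]
  · have hcont : Continuous fun q : E × (E × E) => expInner (R • q.1) (q.2.1 - q.2.2) := by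
      unfold expInner; fun_prop
    exact (hG.comp_snd (stdGaussian E)).mul_bdd (c := 1) hcont.aestronglyMeasurable
      (Eventually.of_forall fun q => (norm_expInner _ _).le)

/-- Wiener's theorem, in a Gaussian form: the Fourier transform of a measure without atoms tends
to zero in quadratic mean. -/
theorem tendsto_integral_normSq_stdGaussian [NullSingletonClass m] {g : E → ℂ} (hg : Integrable g m) :
    Tendsto (fun R : ℕ => ∫ z, ‖∫ x, g x * expInner ((R : ℝ) • z) x ∂m‖ ^ 2 ∂stdGaussian E)
      atTop (𝓝 0) := by
  have hG : Integrable (fun p : E × E => g p.1 * (starRingEnd ℂ) (g p.2)) (m.prod m) :=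
    hg.mul_prod (Complex.conjCLE.toContinuousLinearMap.integrable_comp hg)
  -- As `R → ∞` the Gaussian kernel tends to the indicator of the diagonal, which is a null set
  -- because `m` has no atoms.
  have hdiag : ∀ᵐ p ∂m.prod m, p.1 ≠ p.2 := by
    have hs : MeasurableSet {p : E × E | p.1 = p.2} :=
      (isClosed_eq continuous_fst continuous_snd).measurableSet
    have : m.prod m {p : E × E | p.1 = p.2} = 0 := by
      rw [Measure.measure_prod_null hs]
      refine Eventually.of_forall fun x => ?_
      have : Prod.mk x ⁻¹' {p : E × E | p.1 = p.2} = {x} := by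
        ext y; simp [eq_comm]
      simp [this]
    rw [ae_iff]; simpa using this
  have key : Tendsto (fun R : ℕ => ∫ p, g p.1 * (starRingEnd ℂ) (g p.2) *
        Complex.exp (-(‖(R : ℝ) • (p.1 - p.2)‖ : ℂ) ^ 2 / 2) ∂m.prod m) atTop
      (𝓝 (∫ p, (0 : ℂ) ∂m.prod m)) := by
    refine tendsto_integral_of_dominated_convergence
      (fun p => ‖g p.1 * (starRingEnd ℂ) (g p.2)‖) ?_ hG.norm ?_ ?_
    · intro R
      refine hG.aestronglyMeasurable.mul (Continuous.aestronglyMeasurable ?_)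
      fun_prop
    · intro R
      refine Eventually.of_forall fun p => ?_
      rw [norm_mul]
      refine mul_le_of_le_one_right (norm_nonneg _) ?_
      rw [Complex.norm_exp, Real.exp_le_one_iff]
      rw [← Complex.ofReal_pow, ← Complex.ofReal_neg]
      have : (((-‖(R : ℝ) • (p.1 - p.2)‖ ^ 2 : ℝ) : ℂ) / 2).re =
          -‖(R : ℝ) • (p.1 - p.2)‖ ^ 2 / 2 := by
        rw [← Complex.ofReal_ofNat, ← Complex.ofReal_div, Complex.ofReal_re]
      rw [this]
      have := sq_nonneg ‖(R : ℝ) • (p.1 - p.2)‖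
      linarith
    · filter_upwards [hdiag] with p hp
      have hpos : 0 < ‖p.1 - p.2‖ := norm_pos_iff.2 (sub_ne_zero.2 hp)
      rw [← mul_zero (g p.1 * (starRingEnd ℂ) (g p.2))]
      refine Tendsto.const_mul _ ?_
      have h1 : Tendsto (fun R : ℕ => Real.exp (-((R : ℝ) * ‖p.1 - p.2‖) ^ 2 / 2)) atTop (𝓝 0) := by
        refine Real.tendsto_exp_atBot.comp ?_
        have h2 : Tendsto (fun R : ℕ => ((R : ℝ) * ‖p.1 - p.2‖) ^ 2 / 2) atTop atTop :=
          ((tendsto_pow_atTop two_ne_zero).comp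
            (tendsto_natCast_atTop_atTop.atTop_mul_const hpos)).atTop_div_const two_pos
        simp only [neg_div]
        exact tendsto_neg_atTop_atBot.comp h2
      have h3 := (Complex.continuous_ofReal.tendsto 0).comp h1
      rw [Complex.ofReal_zero] at h3
      refine h3.congr fun R => ?_
      simp [norm_smul]
  rw [integral_zero] at key
  have h := (Complex.continuous_re.tendsto 0).comp key
  rw [Complex.zero_re] at h
  refine h.congr fun R => ?_
  rw [Function.comp_apply, ← ofReal_integral_normSq_stdGaussian hg, Complex.ofReal_re]

/-- Finitely many measures without atoms have simultaneously small Fourier transforms at some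
point. -/
theorem exists_forall_norm_integral_expInner_lt [NullSingletonClass m] {ι : Type*} (s : Finset ι)
    {g : ι → E → ℂ} (hg : ∀ i ∈ s, Integrable (g i) m) {ε : ℝ} (hε : 0 < ε) :
    ∃ t : E, ∀ i ∈ s, ‖∫ x, g i x * expInner t x ∂m‖ < ε := by
  have hlim : Tendsto (fun R : ℕ => ∑ i ∈ s,
      ∫ z, ‖∫ x, g i x * expInner ((R : ℝ) • z) x ∂m‖ ^ 2 ∂stdGaussian E) atTop (𝓝 0) := by
    simpa using tendsto_finsetSum s fun i hi => tendsto_integral_normSq_stdGaussian (hg i hi)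
  obtain ⟨R, hR⟩ := (hlim.eventually_lt_const (pow_pos hε 2)).exists
  have hint : ∀ i ∈ s, Integrable (fun z : E => ‖∫ x, g i x * expInner ((R : ℝ) • z) x ∂m‖ ^ 2)
      (stdGaussian E) := by
    intro i hi
    have hc : Continuous fun z : E => ∫ x, g i x * expInner ((R : ℝ) • z) x ∂m := by
      refine continuous_of_dominated (bound := fun x => ‖g i x‖)
        (fun z => ((hg i hi).mul_expInner _).aestronglyMeasurable)
        (fun z => Eventually.of_forall fun x => by simp [norm_expInner]) (hg i hi).norm
        (Eventually.of_forall fun x => ?_)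
      unfold expInner; fun_prop
    refine Integrable.of_bound (C := (∫ x, ‖g i x‖ ∂m) ^ 2) (hc.norm.pow 2).aestronglyMeasurable
      (Eventually.of_forall fun z => ?_)
    rw [Real.norm_of_nonneg (by positivity)]
    gcongr
    refine (norm_integral_le_integral_norm _).trans (le_of_eq ?_)
    simp [norm_expInner]
  rw [← integral_finsetSum s hint] at hR
  -- The Gaussian is a probability measure, so a mean below `ε ^ 2` forces some value below `ε ^ 2`.
  obtain ⟨z, hz⟩ : ∃ z : E, ∑ i ∈ s, ‖∫ x, g i x * expInner ((R : ℝ) • z) x ∂m‖ ^ 2 < ε ^ 2 := by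
    by_contra! hcon
    have := integral_mono (integrable_const (ε ^ 2)) (integrable_finsetSum s hint) hcon
    simp at this
    linarith
  refine ⟨(R : ℝ) • z, fun i hi => ?_⟩
  refine lt_of_pow_lt_pow_left₀ 2 hε.le (lt_of_le_of_lt ?_ hz)
  exact Finset.single_le_sum (f := fun i => ‖∫ x, g i x * expInner ((R : ℝ) • z) x ∂m‖ ^ 2)
    (fun _ _ => by positivity) hi

end Wiener

/-! ### Characters recurrent on a countable set and weakly null on a continuous measure. -/

section Recurrence

variable {E : Type*} [NormedAddCommGroup E] [InnerProductSpace ℝ E] [FiniteDimensional ℝ E]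
  [MeasurableSpace E] [BorelSpace E] {m : Measure E}

/-- Simultaneous recurrence and smallness: some character is close to `1` at finitely many given
points, and nearly orthogonal to finitely many given measures without atoms. -/
theorem exists_expInner_near_one_and_integral_small [SFinite m] [NullSingletonClass m] {ι : Type*}
    (s : Finset ι) {g : ι → E → ℂ} (hg : ∀ i ∈ s, Integrable (g i) m) {κ : Type*} [Finite κ]
    (u : κ → E) {ε : ℝ} (hε : 0 < ε) :
    ∃ t : E, (∀ k, ‖expInner t (u k) - 1‖ < ε) ∧
      ∀ i ∈ s, ‖∫ x, g i x * expInner t x ∂m‖ < ε := by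
  have := Fintype.ofFinite κ
  -- Each new frequency is handled against all earlier ones at once: modulating the `g i` by the
  -- earlier frequencies leaves a finite family of integrable functions.
  obtain ⟨σ, -, hσ⟩ := exists_seq_of_forall_finset_exists (fun _ : E => True)
    (fun a b => ∀ i ∈ s, ‖∫ x, g i x * expInner (b - a) x ∂m‖ < ε) (by
      intro A _
      obtain ⟨t, ht⟩ := exists_forall_norm_integral_expInner_lt (m := m) (A ×ˢ s)
        (g := fun q x => g q.2 x * expInner (-q.1) x)
        (fun q hq => (hg q.2 (Finset.mem_product.1 hq).2).mul_expInner _) hε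
      refine ⟨t, trivial, fun a ha i hi => ?_⟩
      have := ht (a, i) (Finset.mk_mem_product ha hi)
      simpa only [expInner_sub_left, mul_assoc, mul_comm (expInner t _)] using this)
  -- The values at the points `u k` lie in a compact polydisc, so two terms of the sequence are
  -- `ε`-close there. The difference of their frequencies is the witness.
  obtain ⟨a, -, φ, hφ, hlim⟩ := (isCompact_closedBall (0 : κ → ℂ) 1).tendsto_subseq
    (x := fun q k => expInner (σ q) (u k)) (fun q => by
      rw [mem_closedBall_zero_iff, pi_norm_le_iff_of_nonneg zero_le_one]
      exact fun k => (norm_expInner _ _).le)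
  obtain ⟨N, hN⟩ := Metric.cauchySeq_iff.1 hlim.cauchySeq ε hε
  have hd := hN (N + 1) (Nat.le_succ N) N le_rfl
  refine ⟨σ (φ (N + 1)) - σ (φ N), fun k => ?_, hσ _ _ (hφ (Nat.lt_succ_self N))⟩
  rw [norm_expInner_sub_sub_one]
  exact lt_of_le_of_lt (by
    rw [← dist_eq_norm]
    exact dist_le_pi_dist (fun k => expInner (σ (φ (N + 1))) (u k))
      (fun k => expInner (σ (φ N)) (u k)) k) hd

/-- There is a sequence of characters tending to `1` at each point of a countable set,
and to `0` weakly-* with respect to a measure without atoms. -/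
theorem exists_seq_expInner_tendsto [SigmaFinite m] [NullSingletonClass m] {S : Set E}
    (hS : S.Countable) :
    ∃ t : ℕ → E, (∀ x ∈ S, Tendsto (fun j => expInner (t j) x) atTop (𝓝 1)) ∧
      ∀ g : E → ℂ, Integrable g m →
        Tendsto (fun j => ∫ x, g x * expInner (t j) x ∂m) atTop (𝓝 0) := by
  -- Inserting 0 allows an enumeration even when `S` is empty.
  obtain ⟨u, hu⟩ := (hS.insert 0).exists_eq_range (Set.insert_nonempty 0 S)
  have : Fact ((1 : ℝ≥0∞) ≠ ∞) := ⟨ENNReal.one_ne_top⟩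
  -- Characters have modulus one, so smallness against a dense sequence of `L¹` passes to every
  -- integrable function.
  let d := TopologicalSpace.denseSeq (Lp ℂ 1 m)
  have hd : ∀ k, Integrable (d k) m := fun k => L1.integrable_coeFn (d k)
  have hex : ∀ j : ℕ, ∃ t : E, (∀ k : Fin j, ‖expInner t (u k) - 1‖ < 1 / ((j : ℝ) + 1)) ∧
      ∀ k ∈ Finset.range j, ‖∫ x, d k x * expInner t x ∂m‖ < 1 / ((j : ℝ) + 1) := fun j =>
    exists_expInner_near_one_and_integral_small (Finset.range j) (g := fun k => d k)
      (fun k _ => hd k) (fun k : Fin j => u k) (by positivity)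
  choose t ht1 ht2 using hex
  have hzero := tendsto_one_div_add_atTop_nhds_zero_nat (𝕜 := ℝ)
  refine ⟨t, fun x hx => ?_, fun g hg => ?_⟩
  · obtain ⟨k, rfl⟩ : x ∈ Set.range u := hu ▸ Set.mem_insert_of_mem 0 hx
    rw [tendsto_iff_norm_sub_tendsto_zero]
    refine squeeze_zero' (Eventually.of_forall fun j => norm_nonneg _) ?_ hzero
    filter_upwards [eventually_gt_atTop k] with j hj using (ht1 j ⟨k, hj⟩).le
  · rw [Metric.tendsto_nhds]
    intro ε hε
    obtain ⟨k, hk⟩ := Metric.denseRange_iff.1 (TopologicalSpace.denseRange_denseSeq (Lp ℂ 1 m))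
      hg.toL1 (ε / 2) (half_pos hε)
    have hk' : ∫ x, ‖g x - d k x‖ ∂m < ε / 2 := by
      rw [dist_eq_norm, L1.norm_eq_integral_norm] at hk
      refine lt_of_eq_of_lt (integral_congr_ae ?_) hk
      filter_upwards [hg.coeFn_toL1, Lp.coeFn_sub hg.toL1 (d k)] with x h1 h2
      rw [h2, Pi.sub_apply, h1]
    filter_upwards [hzero.eventually_lt_const (half_pos hε), eventually_gt_atTop k] with j hj hjk
    have hsplit : ∫ x, g x * expInner (t j) x ∂m =
        ∫ x, (g x - d k x) * expInner (t j) x ∂m + ∫ x, d k x * expInner (t j) x ∂m := by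
      have h : Integrable (fun x => (g x - d k x) * expInner (t j) x) m :=
        (hg.sub (hd k)).mul_expInner _
      rw [← integral_add h ((hd k).mul_expInner _)]
      exact integral_congr_ae (Eventually.of_forall fun x => by simp only; ring)
    rw [dist_zero_right, hsplit]
    have h1 : ‖∫ x, (g x - d k x) * expInner (t j) x ∂m‖ ≤ ∫ x, ‖g x - d k x‖ ∂m := by
      refine (norm_integral_le_integral_norm _).trans (le_of_eq ?_)
      simp [norm_expInner]
    have h2 := ht2 j k (Finset.mem_range.2 hjk)
    calc _ ≤ _ := norm_add_le _ _
      _ < ε := by linarith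

end Recurrence

/-! ### Atoms, translates and Fourier transforms of measures. -/

theorem IsSlowlyIncreasing.isLocallyFiniteMeasure {n : ℕ} {m : Measure (Eucl n)}
    (h : IsSlowlyIncreasing m) : IsLocallyFiniteMeasure m := by
  obtain ⟨N, C, hC⟩ := h
  refine ⟨fun x => ⟨Metric.ball 0 (‖x‖ + 1), Metric.isOpen_ball.mem_nhds (by simp), ?_⟩⟩
  exact (hC _ (by simp)).trans_lt ENNReal.ofReal_lt_top

namespace SIMeasure

variable {n : ℕ} (μ : SIMeasure n)

instance : IsLocallyFiniteMeasure μ.variation := μ.slowlyIncreasing.isLocallyFiniteMeasure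

theorem mass_singleton (x : Eucl n) : μ.mass {x} = μ.variation.real {x} * μ.phase x := by
  rw [mass, Measure.restrict_singleton, integral_smul_measure, integral_dirac, measureReal_def]
  simp

theorem phase_ne_zero (x : Eucl n) : μ.phase x ≠ 0 := by
  rw [← norm_ne_zero_iff, μ.norm_phase]; exact one_ne_zero

theorem mem_atoms_iff {x : Eucl n} : x ∈ μ.atoms ↔ μ.variation {x} ≠ 0 := by
  simp only [atoms, Set.mem_ofPred_eq, mass_singleton, ne_eq, mul_eq_zero, μ.phase_ne_zero x,
    or_false, Complex.ofReal_eq_zero]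
  rw [measureReal_def, ENNReal.toReal_eq_zero_iff]
  simp [measure_singleton_lt_top.ne]

theorem countable_atoms : μ.atoms.Countable := by
  have := Measure.countable_meas_pos_of_disjoint_iUnion (μ := μ.variation)
    (As := fun x : Eucl n => {x}) (fun x => measurableSet_singleton x)
    (fun x y hxy => by simpa [Function.onFun] using hxy)
  refine this.mono fun x hx => ?_
  exact pos_iff_ne_zero.2 (μ.mem_atoms_iff.1 hx)

theorem integrable_mul_phase (φ : 𝓢(Eucl n, ℂ)) :
    Integrable (fun x => φ x * μ.phase x) μ.variation := by
  have := μ.slowlyIncreasing.hasTemperateGrowth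
  exact (φ.integrable (μ := μ.variation)).mul_bdd (c := 1)
    μ.measurable_phase.aestronglyMeasurable
    (Eventually.of_forall fun x => (μ.norm_phase x).le)

theorem mass_translate_singleton (τ x : Eucl n) :
    (μ.translate τ).mass {x} = μ.mass {x + τ} := by
  rw [mass_singleton, mass_singleton]
  congr 1
  change ((μ.variation.map (fun y => y - τ)).real {x} : ℂ) = _
  rw [map_measureReal_apply (by fun_prop) (measurableSet_singleton x)]
  congr 2
  ext y
  simp [sub_eq_iff_eq_add]

theorem mem_atoms_translate {τ x : Eucl n} : x ∈ (μ.translate τ).atoms ↔ x + τ ∈ μ.atoms := by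
  simp only [atoms, Set.mem_ofPred_eq, mass_translate_singleton]

variable {μ}

theorem IsPurePoint.translate (h : μ.IsPurePoint) (τ : Eucl n) :
    (μ.translate τ).IsPurePoint := by
  have hs : MeasurableSet (μ.translate τ).atomsᶜ := (μ.translate τ).countable_atoms.measurableSet.compl
  rw [IsPurePoint]
  change μ.variation.map (fun y => y - τ) _ = 0
  rw [Measure.map_apply (by fun_prop) hs]
  have : (fun y => y - τ) ⁻¹' (μ.translate τ).atomsᶜ = μ.atomsᶜ := by
    ext y
    simp [mem_atoms_translate]
  rw [this]
  exact h

variable (μ)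

theorem toDistribution_translate_apply (τ : Eucl n) (φ : 𝓢(Eucl n, ℂ)) :
    (μ.translate τ).toDistribution φ = μ.toDistribution (φ.compSubConstCLM ℂ τ) := by
  rw [toDistribution_apply, toDistribution_apply]
  change ∫ x, φ x * μ.phase (x + τ) ∂μ.variation.map (fun y => y - τ) = _
  rw [integral_map (by fun_prop)]
  · simp
  · exact (φ.continuous.measurable.mul
      (μ.measurable_phase.comp (by fun_prop))).aestronglyMeasurable

variable {μ}

/-- A pure point measure as a sum over its atoms, indexed by an injective family. -/
theorem IsPurePoint.toDistribution_eq_tsum (h : μ.IsPurePoint) {ι : Type*} [Countable ι]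
    {p : ι → Eucl n} (hp : p.Injective) (hsub : μ.atoms ⊆ Set.range p) (φ : 𝓢(Eucl n, ℂ)) :
    μ.toDistribution φ = ∑' k, μ.mass {p k} * φ (p k) := by
  have hc : (Set.range p).Countable := Set.countable_range p
  have hres : μ.variation.restrict (Set.range p) = μ.variation := by
    rw [Measure.restrict_eq_self_of_ae_mem]
    rw [ae_iff]
    exact measure_mono_null (fun x hx hxa => hx (hsub hxa)) h
  rw [toDistribution_apply, ← hres,
    setIntegral_countable _ hc (μ.integrable_mul_phase φ).integrableOn,
    ← (Equiv.ofInjective p hp).tsum_eq]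
  refine tsum_congr fun k => ?_
  simp only [Equiv.ofInjective_apply, mass_singleton, Complex.real_smul]
  ring

/-- Translation becomes modulation on the Fourier side; the factor `2π` appears because `expInner`
is normalised without it. -/
theorem toDistribution_compSubConst_of_fourier {ν : SIMeasure n}
    (hν : 𝓕 μ.toDistribution = ν.toDistribution) (τ : Eucl n) (φ : 𝓢(Eucl n, ℂ)) :
    μ.toDistribution (φ.compSubConstCLM ℂ τ) =
      ∫ x, 𝓕⁻ φ x * ν.phase x * expInner ((2 * Real.pi) • τ) x ∂ν.variation := by
  have h1 : μ.toDistribution (φ.compSubConstCLM ℂ τ) =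
      (𝓕 μ.toDistribution) (𝓕⁻ (φ.compSubConstCLM ℂ τ)) := by
    rw [TemperedDistribution.fourier_apply, FourierTransform.fourier_fourierInv_eq]
  rw [h1, hν, toDistribution_apply]
  refine integral_congr_ae (Eventually.of_forall fun s => ?_)
  have h2 : 𝓕⁻ (φ.compSubConstCLM ℂ τ) s = expInner ((2 * Real.pi) • τ) s * 𝓕⁻ φ s := by
    rw [SchwartzMap.fourierInv_coe, SchwartzMap.fourierInv_coe, Real.fourierInv_eq',
      Real.fourierInv_eq', ← integral_add_right_eq_self _ τ, ← integral_const_mul]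
    refine integral_congr_ae (Eventually.of_forall fun v => ?_)
    simp only [SchwartzMap.compSubConstCLM_apply, add_sub_cancel_right, smul_eq_mul, expInner,
      ← mul_assoc, ← Complex.exp_add]
    congr 2
    rw [inner_add_left, inner_smul_right, real_inner_comm τ s]
    push_cast; ring
  simp only
  rw [h2]; ring

/-- If the atoms of a pure point measure are uniformly discrete and its Fourier transform
is a measure, then its masses are bounded. -/
theorem exists_norm_mass_le_of_fourier {ν : SIMeasure n} (hμ : μ.IsPurePoint)
    (hΛ : IsUniformlyDiscrete μ.atoms) (hν : 𝓕 μ.toDistribution = ν.toDistribution) :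
    ∃ M : ℝ, ∀ x, ‖μ.mass {x}‖ ≤ M := by
  obtain ⟨δ, hδ, hsep⟩ := hΛ
  -- Centred at an atom, this bump is 1 there and 0 at every other atom, so it reads off a single
  -- mass. On the Fourier side the translation only changes a phase, hence a bound independent of
  -- the atom.
  let b : ContDiffBump (0 : Eucl n) := ⟨δ / 2, δ, half_pos hδ, half_lt_self hδ⟩
  have hb1 : HasCompactSupport fun x => (b x : ℂ) :=
    b.hasCompactSupport.comp_left (g := fun x : ℝ => (x : ℂ)) Complex.ofReal_zero
  have hb2 : ContDiff ℝ ((⊤ : ℕ∞) : WithTop ℕ∞) fun x => (b x : ℂ) := Complex.ofRealCLM.contDiff.comp b.contDiff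
  let ψ : 𝓢(Eucl n, ℂ) := hb1.toSchwartzMap hb2
  have hψ : ∀ x, ψ x = b x := fun x => rfl
  refine ⟨∫ s, ‖𝓕⁻ ψ s‖ ∂ν.variation, fun x => ?_⟩
  by_cases hx : x ∈ μ.atoms
  · have := μ.countable_atoms.to_subtype
    have h1 : μ.toDistribution (ψ.compSubConstCLM ℂ x) = μ.mass {x} := by
      rw [hμ.toDistribution_eq_tsum (p := fun a : μ.atoms => (a : Eucl n))
        Subtype.val_injective (by simp), tsum_eq_single ⟨x, hx⟩]
      · simp only [SchwartzMap.compSubConstCLM_apply, sub_self, hψ, b.one_of_mem_closedBall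
          (Metric.mem_closedBall_self (half_pos hδ).le), Complex.ofReal_one, mul_one]
      · rintro ⟨y, hy⟩ hne
        have hne' : y ≠ x := fun h => hne (Subtype.ext h)
        have hd := hsep y hy x hx hne'
        rw [SchwartzMap.compSubConstCLM_apply, hψ, b.zero_of_le_dist, Complex.ofReal_zero,
          mul_zero]
        simpa [dist_eq_norm] using hd
    rw [← h1, toDistribution_compSubConst_of_fourier hν]
    refine (norm_integral_le_integral_norm _).trans (le_of_eq ?_)
    simp [ν.norm_phase, norm_expInner]
  · have : μ.mass {x} = 0 := by simpa [atoms] using hx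
    rw [this, norm_zero]
    positivity

/-- Suitable translates of a measure whose Fourier transform is a measure `ν` have Fourier
transforms converging to the discrete part of `ν`. -/
theorem exists_seq_tendsto_toDistribution_translate {ν : SIMeasure n}
    (hν : 𝓕 μ.toDistribution = ν.toDistribution) :
    ∃ τ : ℕ → Eucl n, Tendsto (fun j => (μ.translate (τ j)).toDistribution) atTop
      (𝓝 (𝓕⁻ ν.discretePart.toDistribution)) := by
  have hms : MeasurableSet ν.atoms := ν.countable_atoms.measurableSet
  have : NullSingletonClass (ν.variation.restrict ν.atomsᶜ) := by
    refine ⟨fun x => ?_⟩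
    rw [Measure.restrict_apply (measurableSet_singleton x)]
    by_cases hx : x ∈ ν.atoms
    · simp [hx]
    · refine measure_mono_null Set.inter_subset_left ?_
      simpa [mem_atoms_iff] using hx
  obtain ⟨t, ht1, ht2⟩ := exists_seq_expInner_tendsto
    (m := ν.variation.restrict ν.atomsᶜ) ν.countable_atoms
  refine ⟨fun j => (2 * Real.pi)⁻¹ • t j,
    PointwiseConvergenceCLM.tendsto_iff_forall_tendsto.2 fun φ => ?_⟩
  have hint := ν.integrable_mul_phase (𝓕⁻ φ)
  have hsplit : ∀ j, (μ.translate ((2 * Real.pi)⁻¹ • t j)).toDistribution φ =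
      (∫ x in ν.atoms, 𝓕⁻ φ x * ν.phase x * expInner (t j) x ∂ν.variation) +
        ∫ x in ν.atomsᶜ, 𝓕⁻ φ x * ν.phase x * expInner (t j) x ∂ν.variation := by
    intro j
    rw [toDistribution_translate_apply, toDistribution_compSubConst_of_fourier hν,
      smul_inv_smul₀ Real.two_pi_pos.ne', integral_add_compl hms (hint.mul_expInner _)]
  simp only [hsplit]
  have hlim : (𝓕⁻ ν.discretePart.toDistribution) φ =
      (∫ x in ν.atoms, 𝓕⁻ φ x * ν.phase x * 1 ∂ν.variation) + 0 := by
    rw [TemperedDistribution.fourierInv_apply, toDistribution_apply]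
    simp [discretePart]
  rw [hlim]
  -- The continuous part vanishes in the limit by the weak convergence; on the atoms dominated
  -- convergence applies.
  refine Tendsto.add ?_ (ht2 _ hint.integrableOn)
  refine tendsto_integral_of_dominated_convergence (fun x => ‖𝓕⁻ φ x * ν.phase x‖)
    (fun j => (hint.mul_expInner _).aestronglyMeasurable.restrict) hint.norm.integrableOn
    (fun j => Eventually.of_forall fun x => ?_) ?_
  · rw [norm_mul, norm_expInner, mul_one]
  · filter_upwards [ae_restrict_mem hms] with x hx
    exact (ht1 x hx).const_mul _

end SIMeasure

/-! ### Measures built from weighted families of points. -/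

theorem SchwartzMap.exists_norm_le_div_one_add_norm_pow {n : ℕ} (φ : 𝓢(Eucl n, ℂ)) (N : ℕ) :
    ∃ C : ℝ, 0 ≤ C ∧ ∀ x, ‖φ x‖ ≤ C * ((1 + ‖x‖) ^ N)⁻¹ := by
  have h := SchwartzMap.one_add_le_sup_seminorm_apply (𝕜 := ℂ) (m := (N, 0)) (k := N) (n := 0)
    le_rfl le_rfl φ
  simp only [norm_iteratedFDeriv_zero] at h
  refine ⟨_, le_trans (by positivity) (h 0), fun x => ?_⟩
  rw [← div_eq_mul_inv, le_div_iff₀ (by positivity), mul_comm]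
  exact h x

namespace SIMeasure

variable {n : ℕ} {ι : Type*}

/-- For `R ≥ 1`, points of the ball satisfy `1 + ‖p k‖ ≤ 2 * R`, so the weighted sum times `(2 * R)
^ N` bounds the mass. -/
theorem isSlowlyIncreasing_sum_dirac {c : ι → ℂ} {p : ι → Eucl n} {N : ℕ}
    (hsum : Summable fun k => ‖c k‖ * ((1 + ‖p k‖) ^ N)⁻¹) :
    IsSlowlyIncreasing (Measure.sum fun k => ‖c k‖ₑ • Measure.dirac (p k)) := by
  refine ⟨N, (∑' k, ‖c k‖ * ((1 + ‖p k‖) ^ N)⁻¹) * 2 ^ N, fun R hR => ?_⟩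
  rw [Measure.sum_apply _ Metric.isOpen_ball.measurableSet, mul_assoc, ← tsum_mul_right,
    ENNReal.ofReal_tsum_of_nonneg (fun k => by positivity) (hsum.mul_right _)]
  refine ENNReal.tsum_le_tsum fun k => ?_
  rw [Measure.smul_apply, Measure.dirac_apply' _ Metric.isOpen_ball.measurableSet, smul_eq_mul]
  by_cases hk : p k ∈ Metric.ball 0 R
  · rw [Set.indicator_of_mem hk, Pi.one_apply, mul_one, ← ofReal_norm]
    refine ENNReal.ofReal_le_ofReal ?_
    rw [mem_ball_zero_iff] at hk
    rw [mul_assoc]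
    refine le_mul_of_one_le_right (norm_nonneg _) ?_
    rw [inv_mul_eq_div, one_le_div (by positivity), ← mul_pow]
    gcongr
    linarith
  · rw [Set.indicator_of_notMem hk, mul_zero]
    exact zero_le

variable [Countable ι]

/-- The pure point measure `∑ c k • δ (p k)`. -/
def ofAtoms (c : ι → ℂ) (p : ι → Eucl n) (N : ℕ)
    (hsum : Summable fun k => ‖c k‖ * ((1 + ‖p k‖) ^ N)⁻¹) (hp : p.Injective) : SIMeasure n where
  variation := Measure.sum fun k => ‖c k‖ₑ • Measure.dirac (p k)
  -- The default value 1 keeps the modulus equal to one off the family and where `c k = 0`.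
  phase := Function.extend p (fun k => if c k = 0 then 1 else c k / ‖c k‖) fun _ => 1
  measurable_phase := by
    refine (measurable_const (a := (1 : ℂ))).measurable_of_countable_ne
      ((Set.countable_range p).mono fun x hx => ?_)
    by_contra hxp
    exact hx (Function.extend_apply' _ (fun _ => (1 : ℂ)) _ hxp).symm
  norm_phase := by
    intro x
    by_cases hx : ∃ k, p k = x
    · obtain ⟨k, rfl⟩ := hx
      rw [hp.extend_apply]
      split_ifs with h
      · simp
      · simp [h]
    · rw [Function.extend_apply' _ _ _ hx, norm_one]
  slowlyIncreasing := isSlowlyIncreasing_sum_dirac hsum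

section ofAtoms

variable {c : ι → ℂ} {p : ι → Eucl n} {N : ℕ}
    (hsum : Summable fun k => ‖c k‖ * ((1 + ‖p k‖) ^ N)⁻¹) (hp : p.Injective)

theorem variation_ofAtoms_apply {s : Set (Eucl n)} (hs : MeasurableSet s) :
    (ofAtoms c p N hsum hp).variation s = ∑' k, ‖c k‖ₑ * s.indicator 1 (p k) := by
  change Measure.sum (fun k => ‖c k‖ₑ • Measure.dirac (p k)) s = _
  rw [Measure.sum_apply _ hs]
  simp only [Measure.smul_apply, Measure.dirac_apply' _ hs, smul_eq_mul]

theorem mem_atoms_ofAtoms {x : Eucl n} :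
    x ∈ (ofAtoms c p N hsum hp).atoms ↔ ∃ k, c k ≠ 0 ∧ p k = x := by
  rw [mem_atoms_iff, variation_ofAtoms_apply hsum hp (measurableSet_singleton x), ne_eq,
    ENNReal.tsum_eq_zero]
  simp [Set.indicator_apply, and_comm]

theorem isPurePoint_ofAtoms : (ofAtoms c p N hsum hp).IsPurePoint := by
  rw [IsPurePoint, variation_ofAtoms_apply hsum hp (countable_atoms _).measurableSet.compl,
    ENNReal.tsum_eq_zero]
  intro k
  by_cases hk : c k = 0
  · simp [hk]
  · rw [Set.indicator_of_notMem, mul_zero]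
    exact fun h => h ((mem_atoms_ofAtoms hsum hp).2 ⟨k, hk, rfl⟩)

theorem toDistribution_ofAtoms_apply (φ : 𝓢(Eucl n, ℂ)) :
    (ofAtoms c p N hsum hp).toDistribution φ = ∑' k, c k * φ (p k) := by
  obtain ⟨C, -, hφ⟩ := φ.exists_norm_le_div_one_add_norm_pow N
  rw [toDistribution_apply]
  change ∫ x, φ x * (ofAtoms c p N hsum hp).phase x
    ∂Measure.sum (fun k => ‖c k‖ₑ • Measure.dirac (p k)) = _
  rw [integral_sum_dirac_eq_tsum (fun k => enorm_ne_top)]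
  · refine tsum_congr fun k => ?_
    have : (ofAtoms c p N hsum hp).phase (p k) = if c k = 0 then 1 else c k / ‖c k‖ :=
      hp.extend_apply (fun k => if c k = 0 then 1 else c k / ‖c k‖) (fun _ => 1) k
    rw [this, toReal_enorm, Complex.real_smul]
    split_ifs with h
    · simp [h]
    · have : (‖c k‖ : ℂ) ≠ 0 := by simpa using h
      field_simp
  · refine (hsum.mul_left C).of_nonneg_of_le (fun k => by positivity) fun k => ?_
    rw [toReal_enorm, norm_mul, norm_phase, mul_one]
    calc _ ≤ ‖c k‖ * (C * ((1 + ‖p k‖) ^ N)⁻¹) := by gcongr; exact hφ _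
      _ = _ := by ring

end ofAtoms

end SIMeasure

/-! ### Grid cells and summable weights. -/

section Cells

variable {n : ℕ}

/-- The index of the cell of the grid of mesh `h` that contains `x`. -/
def gridCell (h : ℝ) (x : Eucl n) : Fin n → ℤ := fun i => ⌊x i / h⌋

theorem gridCell_surjective {h : ℝ} (hh : h ≠ 0) :
    Function.Surjective (gridCell (n := n) h) := by
  intro k
  refine ⟨WithLp.toLp 2 fun i => k i * h, funext fun i => ?_⟩
  simp [gridCell, hh]

/-- Weights on the grid, with summable inverses. -/
def gridWeight (k : Fin n → ℤ) : ℝ := ∏ i, (1 + (k i : ℝ) ^ 2)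

theorem gridWeight_pos (k : Fin n → ℤ) : 0 < gridWeight k :=
  Finset.prod_pos fun i _ => by positivity

/-- A finite index set sits in the box of its coordinate projections, over which the sum factors
into one-dimensional sums. -/
theorem summable_inv_gridWeight : Summable fun k : Fin n → ℤ => (gridWeight k)⁻¹ := by
  have h1 : Summable fun a : ℤ => (1 + (a : ℝ) ^ 2)⁻¹ := by
    refine (Real.summable_one_div_int_pow (p := 2)|>.2 one_lt_two).of_norm_bounded_eventually ?_
    filter_upwards [(Set.finite_singleton (0 : ℤ)).compl_mem_cofinite] with a ha
    have : (0 : ℝ) < (a : ℝ) ^ 2 := by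
      have : (a : ℝ) ≠ 0 := by simpa using ha
      positivity
    rw [Real.norm_of_nonneg (by positivity), one_div]
    gcongr
    linarith
  refine summable_of_sum_le (c := ∏ _i : Fin n, ∑' a : ℤ, (1 + (a : ℝ) ^ 2)⁻¹)
    (fun k => (inv_pos.2 (gridWeight_pos k)).le) fun s => ?_
  have hsub : s ⊆ Fintype.piFinset fun i => s.image fun k => k i := fun k hk =>
    Fintype.mem_piFinset.2 fun i => Finset.mem_image_of_mem _ hk
  refine (Finset.sum_le_sum_of_subset_of_nonneg hsub
    fun k _ _ => (inv_pos.2 (gridWeight_pos k)).le).trans ?_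
  simp only [gridWeight, ← Finset.prod_inv_distrib]
  rw [← Finset.prod_univ_sum (fun i => s.image fun k : Fin n → ℤ => k i)
    (fun _ (a : ℤ) => (1 + (a : ℝ) ^ 2)⁻¹)]
  exact Finset.prod_le_prod (fun i _ => Finset.sum_nonneg fun a _ => by positivity)
    fun i _ => h1.sum_le_tsum _ fun a _ => by positivity

/-- Makes `(1 + ‖x‖) ^ (-2n)`, at one point per cell, summable over the cells. This fixes the
exponent `2 * n` in the compactness argument. -/
theorem gridWeight_gridCell_le {h : ℝ} (hh : 0 < h) (x : Eucl n) :
    gridWeight (gridCell h x) ≤ ((2 + h⁻¹) ^ 2) ^ n * (1 + ‖x‖) ^ (2 * n) := by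
  have h1 : ∀ i, 1 + ((gridCell h x i : ℤ) : ℝ) ^ 2 ≤ (2 + h⁻¹) ^ 2 * (1 + ‖x‖) ^ 2 := by
    intro i
    have hx : |x i / h| ≤ ‖x‖ * h⁻¹ := by
      rw [abs_div, abs_of_pos hh, div_eq_mul_inv]
      gcongr
      exact PiLp.norm_apply_le x i
    have ha : |((gridCell h x i : ℤ) : ℝ)| ≤ ‖x‖ * h⁻¹ + 1 := by
      have h2 := Int.floor_le (x i / h)
      have h3 := Int.lt_floor_add_one (x i / h)
      rw [abs_le] at hx ⊢
      simp only [gridCell]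
      constructor <;> linarith
    have hinv := inv_pos.2 hh
    calc 1 + ((gridCell h x i : ℤ) : ℝ) ^ 2 ≤ (1 + |((gridCell h x i : ℤ) : ℝ)|) ^ 2 := by
          rw [add_sq, sq_abs]
          have := abs_nonneg ((gridCell h x i : ℤ) : ℝ)
          linarith
      _ ≤ ((2 + h⁻¹) * (1 + ‖x‖)) ^ 2 := by
          gcongr
          have := mul_nonneg (norm_nonneg x) hinv.le
          nlinarith [norm_nonneg x]
      _ = _ := mul_pow _ _ _
  calc gridWeight (gridCell h x) ≤ ∏ _i : Fin n, (2 + h⁻¹) ^ 2 * (1 + ‖x‖) ^ 2 :=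
        Finset.prod_le_prod (fun i _ => by positivity) fun i _ => h1 i
    _ = _ := by simp [mul_pow, pow_mul]

/-- Points in the same cell are close. -/
theorem dist_lt_of_gridCell_eq {h δ : ℝ} (hh : 0 < h) (hδ : (n : ℝ) * h < δ)
    {x y : Eucl n} (hxy : gridCell h x = gridCell h y) : dist x y < δ := by
  refine lt_of_le_of_lt ?_ hδ
  have h1 : ∀ i, ‖(x - y) i‖ ≤ h := by
    intro i
    have h2 := Int.abs_sub_lt_one_of_floor_eq_floor (congrFun hxy i)
    rw [← sub_div, abs_div, abs_of_pos hh, div_lt_one hh] at h2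
    simpa using h2.le
  rw [dist_eq_norm]
  calc ‖x - y‖ = ‖∑ i, EuclideanSpace.single i ((x - y) i)‖ := by
        congr 1
        ext j
        simp [Finset.sum_apply]
    _ ≤ ∑ i : Fin n, h := (norm_sum_le _ _).trans (Finset.sum_le_sum fun i _ => by
        rw [PiLp.norm_single]; exact h1 i)
    _ = n * h := by simp

/-- Points of a cell lie in a bounded set. -/
theorem exists_forall_gridCell_eq_norm_le {h : ℝ} (hh : 0 < h) (k : Fin n → ℤ) :
    ∃ B : ℝ, ∀ x : Eucl n, gridCell h x = k → ‖x‖ ≤ B := by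
  obtain ⟨y, hy⟩ := gridCell_surjective (n := n) hh.ne' k
  refine ⟨(n * h + 1) + ‖y‖, fun x hx => ?_⟩
  have := dist_lt_of_gridCell_eq hh (lt_add_one _) (hx.trans hy.symm)
  rw [dist_eq_norm] at this
  have h2 := norm_add_le (x - y) y
  rw [sub_add_cancel] at h2
  linarith

end Cells

/-! ### Compactness, and passage of separation to the limit. -/

/-- Compactness: the limit of a sequence of pure point measures with bounded masses and uniformly
separated atoms is a pure point measure, whose atoms are limits of atoms along an ultrafilter. -/
theorem SIMeasure.exists_isPurePoint_of_tendsto {n : ℕ} {m : ℕ → SIMeasure n}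
    (hm : ∀ j, (m j).IsPurePoint) {M : ℝ} (hM : ∀ j x, ‖(m j).mass {x}‖ ≤ M) {δ : ℝ} (hδ : 0 < δ)
    (hsep : ∀ j, ∀ x ∈ (m j).atoms, ∀ y ∈ (m j).atoms, x ≠ y → δ ≤ dist x y)
    {α : 𝓢'(Eucl n, ℂ)} (hα : Tendsto (fun j => (m j).toDistribution) atTop (𝓝 α)) :
    ∃ μ' : SIMeasure n, μ'.toDistribution = α ∧ μ'.IsPurePoint ∧
      ∀ x ∈ μ'.atoms, ∃ q : ℕ → Eucl n, Tendsto q (hyperfilter ℕ : Filter ℕ) (𝓝 x) ∧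
        ∀ᶠ j in (hyperfilter ℕ : Filter ℕ), q j ∈ (m j).atoms := by
  -- Points of one cell are then less than `δ` apart, so a cell holds at most one atom; the `+ 1`
  -- also covers `n = 0`.
  set h : ℝ := δ / (n + 1)
  have hh : 0 < h := by positivity
  have hnh : (n : ℝ) * h < δ := by
    rw [mul_div_assoc', div_lt_iff₀ (by positivity)]
    linarith
  have hM0 : 0 ≤ M := (norm_nonneg _).trans (hM 0 0)
  -- The representative of a cell is its atom if there is one, otherwise any point of it, whose mass
  -- is then zero.
  have hex : ∀ j k, ∃ x, gridCell h x = k ∧ ∀ y ∈ (m j).atoms, gridCell h y = k → y = x := by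
    intro j k
    by_cases hk : ∃ x ∈ (m j).atoms, gridCell h x = k
    · obtain ⟨x, hx, rfl⟩ := hk
      refine ⟨x, rfl, fun y hy hyx => ?_⟩
      by_contra hne
      exact (hsep j y hy x hx hne).not_gt (dist_lt_of_gridCell_eq hh hnh hyx)
    · obtain ⟨x, hx⟩ := gridCell_surjective (n := n) hh.ne' k
      exact ⟨x, hx, fun y hy hyk => (hk ⟨y, hy, hyk⟩).elim⟩
  choose p hpk hpu using hex
  have hpinj : ∀ j, (p j).Injective := fun j => Function.LeftInverse.injective (hpk j)
  have hrange : ∀ j, (m j).atoms ⊆ Set.range (p j) := fun j y hy =>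
    ⟨gridCell h y, (hpu j _ y hy rfl).symm⟩
  -- An ultrafilter makes all bounded families converge simultaneously, with no diagonal extraction.
  have hC : ∀ k, ∃ a : ℂ, Tendsto (fun j => (m j).mass {p j k}) (hyperfilter ℕ) (𝓝 a) := by
    intro k
    obtain ⟨a, -, ha⟩ := (isCompact_closedBall (0 : ℂ) M).ultrafilter_le_nhds'
      ((hyperfilter ℕ).map fun j => (m j).mass {p j k}) (Ultrafilter.mem_map.2 <| univ_mem' fun j => mem_closedBall_zero_iff.2 (hM j _))
    exact ⟨a, ha⟩
  have hP : ∀ k, ∃ a : Eucl n, Tendsto (fun j => p j k) (hyperfilter ℕ) (𝓝 a) := by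
    intro k
    obtain ⟨B, hB⟩ := exists_forall_gridCell_eq_norm_le (n := n) hh k
    obtain ⟨a, -, ha⟩ := (isCompact_closedBall (0 : Eucl n) B).ultrafilter_le_nhds'
      ((hyperfilter ℕ).map fun j => p j k) (Ultrafilter.mem_map.2 <| univ_mem' fun j => mem_closedBall_zero_iff.2 (hB _ (hpk j k)))
    exact ⟨a, ha⟩
  choose c hc using hC
  choose P hP using hP
  have hcM : ∀ k, ‖c k‖ ≤ M := fun k =>
    le_of_tendsto (hc k).norm (Eventually.of_forall fun j => hM j _)
  set D : ℝ := ((2 + h⁻¹) ^ 2) ^ n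
  have hD : 0 < D := by positivity
  have hinv : ∀ (k : Fin n → ℤ) (x : Eucl n), gridWeight k ≤ D * (1 + ‖x‖) ^ (2 * n) →
      ((1 + ‖x‖) ^ (2 * n))⁻¹ ≤ D * (gridWeight k)⁻¹ := by
    intro k x hx
    rw [← div_eq_mul_inv, le_div_iff₀ (gridWeight_pos k), inv_mul_le_iff₀ (by positivity),
      mul_comm]
    exact hx
  have hpw : ∀ j k, ((1 + ‖p j k‖) ^ (2 * n))⁻¹ ≤ D * (gridWeight k)⁻¹ := fun j k =>
    hinv k _ (by simpa only [hpk] using gridWeight_gridCell_le hh (p j k))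
  have hPw : ∀ k, ((1 + ‖P k‖) ^ (2 * n))⁻¹ ≤ D * (gridWeight k)⁻¹ := fun k => by
    have hlim := ((hP k).norm.const_add 1).pow (2 * n)
    exact le_of_tendsto (hlim.inv₀ (by positivity)) (Eventually.of_forall fun j => hpw j k)
  have hmem : ∀ k, c k ≠ 0 → ∀ᶠ j in (hyperfilter ℕ : Filter ℕ), p j k ∈ (m j).atoms :=
    fun k hk => (hc k).eventually_ne hk
  -- Limits from adjacent cells may coincide on a common boundary, but not when both limit masses
  -- are nonzero: both then come from genuine atoms, at distance at least `δ`. Hence the restriction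
  -- to `c k ≠ 0` below.
  have hPsep : ∀ k l, c k ≠ 0 → c l ≠ 0 → P k = P l → k = l := by
    intro k l hk hl hkl
    by_contra hne
    have h1 : δ ≤ dist (P k) (P l) := by
      refine ge_of_tendsto ((hP k).dist (hP l)) ?_
      filter_upwards [hmem k hk, hmem l hl] with j hjk hjl
      exact hsep j _ hjk _ hjl fun heq => hne (hpinj j heq)
    rw [hkl, dist_self] at h1
    exact h1.not_gt hδ
  have hsum : Summable fun k : {k // c k ≠ 0} => ‖c k‖ * ((1 + ‖P k‖) ^ (2 * n))⁻¹ := by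
    refine Summable.comp_injective (i := Subtype.val)
      (f := fun k => ‖c k‖ * ((1 + ‖P k‖) ^ (2 * n))⁻¹) ?_ Subtype.val_injective
    refine (summable_inv_gridWeight.mul_left (M * D)).of_nonneg_of_le (fun k => by positivity)
      fun k => ?_
    rw [mul_assoc]
    exact mul_le_mul (hcM k) (hPw k) (by positivity) hM0
  have hPinj : Function.Injective fun k : {k // c k ≠ 0} => P k := fun k l hkl =>
    Subtype.ext (hPsep k l k.2 l.2 hkl)
  refine ⟨ofAtoms _ _ _ hsum hPinj, ?_, isPurePoint_ofAtoms hsum hPinj, fun x hx => ?_⟩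
  · ext φ
    obtain ⟨C, hC0, hφ⟩ := φ.exists_norm_le_div_one_add_norm_pow (2 * n)
    rw [toDistribution_ofAtoms_apply hsum hPinj]
    have hsub : ∑' k : {k // c k ≠ 0}, c k * φ (P k) = ∑' k, c k * φ (P k) :=
      tsum_subtype_eq_of_support_subset (s := {k | c k ≠ 0}) (f := fun k => c k * φ (P k))
        fun k hk => left_ne_zero_of_mul hk
    rw [hsub]
    -- Convergence of the whole sequence identifies the ultrafilter limit with `α`.
    have hlim : Tendsto (fun j => (m j).toDistribution φ) (hyperfilter ℕ) (𝓝 (α φ)) :=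
      (PointwiseConvergenceCLM.tendsto_iff_forall_tendsto.1 hα φ).mono_left Nat.hyperfilter_le_atTop
    refine tendsto_nhds_unique ?_ hlim
    simp only [(hm _).toDistribution_eq_tsum (hpinj _) (hrange _) φ]
    refine tendsto_tsum_of_dominated_convergence
      (summable_inv_gridWeight.mul_left (M * (C * D)))
      (fun k => (hc k).mul ((φ.continuous.tendsto _).comp (hP k)))
      (Eventually.of_forall fun j k => ?_)
    calc ‖(m j).mass {p j k} * φ (p j k)‖ ≤ M * (C * (D * (gridWeight k)⁻¹)) := by
          rw [norm_mul]
          refine mul_le_mul (hM j _) ((hφ _).trans ?_) (norm_nonneg _) hM0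
          exact mul_le_mul_of_nonneg_left (hpw j k) hC0
      _ = _ := by ring
  · obtain ⟨k, hk, rfl⟩ := (mem_atoms_ofAtoms hsum hPinj).1 hx
    exact ⟨fun j => p j k, hP k, hmem k hk⟩

/-- Uniform discreteness passes to sets of limits of points of uniformly discrete sets. -/
theorem IsUniformlyDiscrete.of_forall_exists_tendsto {n : ℕ} {A B : Set (Eucl n)}
    (hA : IsUniformlyDiscrete A) {l : Filter ℕ} [l.NeBot] {τ : ℕ → Eucl n}
    (hB : ∀ x ∈ B, ∃ q : ℕ → Eucl n, Tendsto q l (𝓝 x) ∧ ∀ᶠ j in l, q j + τ j ∈ A) :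
    IsUniformlyDiscrete B := by
  obtain ⟨δ, hδ, hsep⟩ := hA
  refine ⟨δ, hδ, fun x hx y hy hxy => ?_⟩
  obtain ⟨q, hq, hqA⟩ := hB x hx
  obtain ⟨r, hr, hrA⟩ := hB y hy
  -- Distinct limits force `q j ≠ r j` eventually, and the common shift `τ j` does not affect
  -- distances.
  refine ge_of_tendsto (hq.dist hr) ?_
  filter_upwards [hqA, hrA, (hq.dist hr).eventually_ne (dist_ne_zero.2 hxy)] with j h1 h2 h3
  simpa using hsep _ h1 _ h2 fun h => h3 (by rw [add_right_cancel h, dist_self])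

end

theorem mainTheorem10 (n : ℕ) (μ ν : SIMeasure n)
    (hμ : μ.IsPurePoint) (hΛ : IsUniformlyDiscrete μ.atoms)
    (hν : 𝓕 μ.toDistribution = ν.toDistribution) :
    ∃ μ' : SIMeasure n,
      𝓕 μ'.toDistribution = ν.discretePart.toDistribution ∧
      (∃ τ : ℕ → Eucl n, Filter.Tendsto (fun j => (μ.translate (τ j)).toDistribution)
        Filter.atTop (𝓝 μ'.toDistribution)) ∧
      μ'.IsPurePoint ∧
      IsUniformlyDiscrete μ'.atoms ∧
      (IsUniformlyDiscrete (μ.atoms - μ.atoms) →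
        IsUniformlyDiscrete (μ'.atoms - μ'.atoms)) := by
  obtain ⟨M, hM⟩ := SIMeasure.exists_norm_mass_le_of_fourier hμ hΛ hν
  obtain ⟨τ, hτ⟩ := SIMeasure.exists_seq_tendsto_toDistribution_translate hν
  obtain ⟨δ, hδ, hsep⟩ := id hΛ
  obtain ⟨μ', hμ'1, hμ'2, hμ'3⟩ := SIMeasure.exists_isPurePoint_of_tendsto
    (fun j => hμ.translate (τ j)) (M := M)
    (fun j x => by rw [SIMeasure.mass_translate_singleton]; exact hM _) hδ
    (fun j x hx y hy hxy => by
      rw [SIMeasure.mem_atoms_translate] at hx hy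
      simpa using hsep _ hx _ hy fun h => hxy (add_right_cancel h)) hτ
  simp only [SIMeasure.mem_atoms_translate] at hμ'3
  refine ⟨μ', ?_, ⟨τ, hμ'1 ▸ hτ⟩, hμ'2, hΛ.of_forall_exists_tendsto hμ'3, fun hdiff =>
    hdiff.of_forall_exists_tendsto (l := Filter.hyperfilter ℕ) (τ := 0) ?_⟩
  · rw [hμ'1, FourierTransform.fourier_fourierInv_eq]
  -- The shifts cancel in differences of atoms, so the limit criterion is used with `τ = 0`.
  · rintro _ ⟨x, hx, y, hy, rfl⟩
    obtain ⟨q, hq, hqA⟩ := hμ'3 x hx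
    obtain ⟨r, hr, hrA⟩ := hμ'3 y hy
    refine ⟨fun j => q j - r j, hq.sub hr, ?_⟩
    filter_upwards [hqA, hrA] with j h1 h2
    simpa using Set.sub_mem_sub h1 h2
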